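/- Assume GCH. Let $\mu$ be a regular (infinite) cardinal and $\lambda=\mu^+$. Let $S\subseteq\lambda$ be a stationary set of ordinals of cofinality $\mu$, and let $\bar\eta=\{\eta_\delta:\delta\in S\}$ be a ladder system on $S$, that is, each $\eta_\delta:\mu\to\delta$ is strictly increasing and cofinal in $\delta$. If $\mu>\aleph_0$, let $E\subseteq\mu$ be a stationary set of ordinals of cofinality $\omega$, and let $\bar\zeta=\{\zeta_\nu:\nu\in E\}$ be a ladder system on $E$, that is, each $\zeta_\nu:\omega\to\nu$ is strictly increasing and cofinal in $\nu$; if $\mu=\aleph_0$, put $E=\{0\}$. Let $F$ be the free abelian group on the symbols $y_{\delta,\nu,n}$ ($\delta\in S$, $\nu\in E$, $n\in\omega$), $z_{\delta,j}$ ($\delta\in S$, $j<\mu$) and $x_\beta$ ($\beta<\lambda$), let $K$ be the subgroup of $F$ generated by the elements $$w_{\delta,\nu,n}=2y_{\delta,\nu,n+1}-y_{\delta,\nu,n}-z_{\delta,\zeta_\nu(n)}+x_{\eta_\delta(\nu+n)}\qquad(\delta\in S,\ \nu\in E,\ n\in\omega),$$ where for $\mu=\aleph_0$ the symbols $z_{\delta,j}$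 and the terms $z_{\delta,\zeta_\nu(n)}$ are omitted, and let $H$ be a group isomorphic to $F/K$ (the group built on $\bar\eta$ and $\bar\zeta$). Suppose also that, if $\mu>\aleph_0$, the diamond principle $\diamondsuit_\mu(E')$ holds for every stationary subset $E'$ of $\mu$ with $E'\subseteq E$. If $A$ is a Whitehead group (an abelian group with $\mathrm{Ext}(A,\mathbb Z)=0$) of cardinality $\lambda=\mu^+$, then $\mathrm{Ext}(H,A)\neq 0$. -/

import Mathlib

universe u

namespace WhiteheadExt

open Cardinal Set

/-- The generalized continuum hypothesis. -/
def GCH : Prop :=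
  ∀ κ : Cardinal.{u}, ℵ₀ ≤ κ → (2 : Cardinal.{u}) ^ κ = Order.succ κ

/-- `X ∩ κ` is a stationary subset of the cardinal `κ` (viewed as an initial ordinal). -/
def IsStationaryIn (κ : Cardinal.{u}) (X : Set Ordinal.{u}) : Prop :=
  IsStationary {a : Iio κ.ord | (a : Ordinal.{u}) ∈ X}

/-- The diamond principle `◇_κ(E)`. -/
def Diamond (κ : Cardinal.{u}) (E : Set Ordinal.{u}) : Prop :=
  ∃ D : Ordinal.{u} → Set Ordinal.{u}, ∀ X : Set Ordinal.{u},
    IsStationaryIn κ {α | α ∈ E ∧ X ∩ Iio α = D α}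

/-- A ladder system on `S`, with ladders indexed by the subset `I` of the ordered type `ι`:
for every `δ ∈ S` the function `η δ` is strictly increasing from `I` to `δ`, and cofinal in `δ`. -/
structure IsLadderSystem {ι : Type*} [Preorder ι] (I : Set ι) (S : Set Ordinal.{u})
    (η : Ordinal.{u} → ι → Ordinal.{u}) : Prop where
  strictMono : ∀ δ ∈ S, StrictMonoOn (η δ) I
  lt : ∀ δ ∈ S, ∀ i ∈ I, η δ i < δ
  cofinal : ∀ δ ∈ S, ∀ β < δ, ∃ i ∈ I, β ≤ η δ i

/-- The combinatorial data on the successor `λ = μ⁺` of a cardinal `μ` of cofinality `σ`: a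
stationary set `S ⊆ λ` of ordinals of cofinality `σ` with a ladder system `η` of ladders of length
`σ`; and, if `σ > ℵ₀`, a stationary set `E ⊆ σ` of ordinals of cofinality `ω` with a ladder system
`ζ` of ladders of length `ω`. If `σ = ℵ₀`, then `E = {0}` and `ζ` is irrelevant. -/
structure IsLadderPair (μ : Cardinal.{u}) (S : Set Ordinal.{u})
    (η : Ordinal.{u} → Ordinal.{u} → Ordinal.{u}) (E : Set Ordinal.{u})
    (ζ : Ordinal.{u} → ℕ → Ordinal.{u}) : Prop where
  S_subset : S ⊆ Iio (Order.succ μ).ord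
  S_cof : ∀ δ ∈ S, δ.cof = μ.ord.cof
  S_stationary : IsStationaryIn (Order.succ μ) S
  ladder_η : IsLadderSystem (Iio μ.ord.cof.ord) S η
  E_countable : μ.ord.cof = ℵ₀ → E = {0}
  E_subset : ℵ₀ < μ.ord.cof → E ⊆ Iio μ.ord.cof.ord
  E_cof : ℵ₀ < μ.ord.cof → ∀ ν ∈ E, ν.cof = ℵ₀
  E_stationary : ℵ₀ < μ.ord.cof → IsStationaryIn μ.ord.cof E
  ladder_ζ : ℵ₀ < μ.ord.cof → IsLadderSystem (univ : Set ℕ) E ζ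

/-- The symbols `y_{δ,ν,n}`, `z_{δ,j}` and `x_β`. -/
inductive Sym : Type (u + 1)
  | y (δ ν : Ordinal.{u}) (n : ℕ) : Sym
  | z (δ j : Ordinal.{u}) : Sym
  | x (β : Ordinal.{u}) : Sym

/-- The symbols that are used: `y_{δ,ν,n}` for `δ ∈ S`, `ν ∈ E`, `n ∈ ω`; `x_β` for `β < μ⁺`; and,
unless `σ = cf(μ)` is countable, `z_{δ,j}` for `δ ∈ S`, `j < σ`. -/
def symbols (μ : Cardinal.{u}) (S E : Set Ordinal.{u}) : Set Sym.{u} :=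
  {s | (∃ δ ∈ S, ∃ ν ∈ E, ∃ n : ℕ, s = Sym.y δ ν n) ∨
    (ℵ₀ < μ.ord.cof ∧ ∃ δ ∈ S, ∃ j < μ.ord.cof.ord, s = Sym.z δ j) ∨
    (∃ β < (Order.succ μ).ord, s = Sym.x β)}

/-- The free abelian group `F` on `symbols μ S E`, as the group of all finitely supported functions
with support in this set. -/
noncomputable def F (μ : Cardinal.{u}) (S E : Set Ordinal.{u}) : Submodule ℤ (Sym.{u} →₀ ℤ) :=
  Finsupp.supported ℤ ℤ (symbols μ S E)

open Classical in
/-- `w_{δ,ν,n} = 2 y_{δ,ν,n+1} - y_{δ,ν,n} - z_{δ,ζ_ν(n)} + x_{η_δ(ν+n)}`, where the term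
`z_{δ,ζ_ν(n)}` is omitted if `cf(μ)` is countable. -/
noncomputable def w (μ : Cardinal.{u}) (η : Ordinal.{u} → Ordinal.{u} → Ordinal.{u})
    (ζ : Ordinal.{u} → ℕ → Ordinal.{u}) (δ ν : Ordinal.{u}) (n : ℕ) : Sym.{u} →₀ ℤ :=
  (2 : ℤ) • Finsupp.single (Sym.y δ ν (n + 1)) 1 - Finsupp.single (Sym.y δ ν n) 1
    - (if ℵ₀ < μ.ord.cof then Finsupp.single (Sym.z δ (ζ ν n)) 1 else 0)
    + Finsupp.single (Sym.x (η δ (ν + n))) 1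

/-- The subgroup `K` generated by all `w_{δ,ν,n}` with `δ ∈ S`, `ν ∈ E`, `n ∈ ω`. -/
noncomputable def K (μ : Cardinal.{u}) (S : Set Ordinal.{u})
    (η : Ordinal.{u} → Ordinal.{u} → Ordinal.{u}) (E : Set Ordinal.{u})
    (ζ : Ordinal.{u} → ℕ → Ordinal.{u}) : Submodule ℤ (Sym.{u} →₀ ℤ) :=
  Submodule.span ℤ {v | ∃ δ ∈ S, ∃ ν ∈ E, ∃ n : ℕ, v = w μ η ζ δ ν n}

/-- `H` is (isomorphic to) the group `F / K` built on the ladder systems `η = (η_δ : δ ∈ S)` and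
`ζ = (ζ_ν : ν ∈ E)`. -/
structure IsBuiltOn (μ : Cardinal.{u}) (S : Set Ordinal.{u})
    (η : Ordinal.{u} → Ordinal.{u} → Ordinal.{u}) (E : Set Ordinal.{u})
    (ζ : Ordinal.{u} → ℕ → Ordinal.{u}) (H : Type u) [AddCommGroup H] : Prop where
  ladders : IsLadderPair μ S η E ζ
  iso : Nonempty (H ≃+ (F μ S E ⧸ (K μ S η E ζ).submoduleOf (F μ S E)))

/-- The group `Ext(H, A)` of abelian groups. -/
abbrev ExtOne (H A : Type u) [AddCommGroup H] [AddCommGroup A] : Type u :=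
  CategoryTheory.Abelian.Ext (ModuleCat.of ℤ H) (ModuleCat.of ℤ A) 1

/-- A Whitehead group: an abelian group `A` with `Ext(A, ℤ) = 0`. -/
def IsWhitehead (A : Type u) [AddCommGroup A] : Prop :=
  Subsingleton (ExtOne A (ULift.{u} ℤ))

end WhiteheadExt

/-!
If `Ext(H, A) = 0`, then the equations
`2 y_{δ,ν,n+1} - y_{δ,ν,n} - z_{δ,ζ_ν(n)} + x_{η_δ(ν+n)} = a_{δ,ν,n}` have a solution in `A` for all
right-hand sides. Closing off at some `δ ∈ S` removes the terms `x_β`: there is a `B ≤ A` of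
cardinality at most `μ` such that all systems `2 y_{ν,n+1} - y_{ν,n} - z_{ζ_ν(n)} = c_{ν,n}` are
solvable in `A / B`, and hence in `A / P` for all `P ≥ B`. On the other hand, guessing `z` by means
of the diamond on `E` gives integers `ε_{ν,n}` such that the system with `c = ε m` is not solvable
in `ℤ` for any `m ≠ 0`. As Whitehead groups are torsionless, a system with `c = ε g`, `g ≠ 0`, is
not solvable in a Whitehead group either; hence, if `B ≤ P` and `A / P ≠ 0`, then `A / P` has a
subgroup of cardinality at most `μ` that is not a Whitehead group. But `2 ^ μ < 2 ^ μ⁺` implies, by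
a weak diamond argument, that this fails for some `P ≥ B` of cardinality at most `μ`.
-/

universe v

namespace WhiteheadExt

open Cardinal Set

section ExtVanishing

open CategoryTheory Abelian

variable {X Y Z G : Type u} [AddCommGroup X] [AddCommGroup Y] [AddCommGroup Z] [AddCommGroup G]

theorem exists_extension_of_subsingleton_extOne {i : X →ₗ[ℤ] Y} {p : Y →ₗ[ℤ] Z}
    (hi : Function.Injective i) (hp : Function.Surjective p) (hip : Function.Exact i p)
    (h : Subsingleton (ExtOne Z G)) (f : X →ₗ[ℤ] G) : ∃ g : Y →ₗ[ℤ] G, g ∘ₗ i = f := by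
  have hS := ModuleCat.shortComplex_shortExact
    (ModuleCat.shortComplexOfCompEqZero i p hip.linearMap_comp_eq_zero) hip hi hp
  obtain ⟨g, hg⟩ := Ext.contravariant_sequence_exact₁ hS (ModuleCat.of ℤ G)
    (Ext.mk₀ (ModuleCat.ofHom f)) (n₁ := 1) rfl (h.elim _ _)
  obtain ⟨g, rfl⟩ := (Ext.mk₀_bijective _ _).2 g
  rw [Ext.mk₀_comp_mk₀] at hg
  exact ⟨g.hom, congrArg ModuleCat.Hom.hom ((Ext.mk₀_bijective _ _).1 hg)⟩

theorem exists_lift_of_subsingleton_extOne {i : X →ₗ[ℤ] Y} {p : Y →ₗ[ℤ] Z}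
    (hi : Function.Injective i) (hp : Function.Surjective p) (hip : Function.Exact i p)
    (h : Subsingleton (ExtOne G X)) (f : G →ₗ[ℤ] Z) : ∃ g : G →ₗ[ℤ] Y, p ∘ₗ g = f := by
  have hS := ModuleCat.shortComplex_shortExact
    (ModuleCat.shortComplexOfCompEqZero i p hip.linearMap_comp_eq_zero) hip hi hp
  obtain ⟨g, hg⟩ := Ext.covariant_sequence_exact₃ (ModuleCat.of ℤ G) hS
    (Ext.mk₀ (ModuleCat.ofHom f)) (n₁ := 1) rfl (h.elim _ _)
  obtain ⟨g, rfl⟩ := (Ext.mk₀_bijective _ _).2 g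
  rw [Ext.mk₀_comp_mk₀] at hg
  exact ⟨g.hom, congrArg ModuleCat.Hom.hom ((Ext.mk₀_bijective _ _).1 hg)⟩

end ExtVanishing

theorem exists_extension_of_subsingleton_extOne_of_small {M : Type v} [AddCommGroup M]
    [Small.{u} M] (N : Submodule ℤ M) {H A : Type u} [AddCommGroup H] [AddCommGroup A]
    (e : H ≃+ (M ⧸ N)) (h : Subsingleton (ExtOne H A)) (f : N →ₗ[ℤ] A) :
    ∃ g : M →ₗ[ℤ] A, g ∘ₗ N.subtype = f := by
  let eM := Shrink.linearEquiv.{u} ℤ M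
  let eN := Shrink.linearEquiv.{u} ℤ N
  let i : Shrink.{u} N →ₗ[ℤ] Shrink.{u} M := eM.symm.toLinearMap ∘ₗ N.subtype ∘ₗ eN.toLinearMap
  let p : Shrink.{u} M →ₗ[ℤ] H :=
    e.symm.toIntLinearEquiv.toLinearMap ∘ₗ N.mkQ ∘ₗ eM.toLinearMap
  have hi : Function.Injective i :=
    eM.symm.injective.comp (N.injective_subtype.comp eN.injective)
  have hp : Function.Surjective p :=
    e.symm.surjective.comp (N.mkQ_surjective.comp eM.surjective)
  have hip : Function.Exact i p := fun x => by
    have hpx : p x = 0 ↔ eM x ∈ N := by simp [p]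
    have hix : x ∈ Set.range i ↔ ∃ y : N, (y : M) = eM x := by
      simp [i, eN.surjective.exists, LinearEquiv.symm_apply_eq]
    rw [hpx, hix, Subtype.exists]
    simp
  obtain ⟨g, hg⟩ := exists_extension_of_subsingleton_extOne hi hp hip h (f ∘ₗ eN.toLinearMap)
  refine ⟨g ∘ₗ eM.symm.toLinearMap, LinearMap.ext fun x => ?_⟩
  simpa [i] using LinearMap.congr_fun hg (eN.symm x)

theorem exists_linearMap_of_subsingleton_extOne {M : Type v} [AddCommGroup M] [Small.{u} M]
    {ι : Type*} {v : ι → M} (hv : LinearIndependent ℤ v) {H A : Type u} [AddCommGroup H]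
    [AddCommGroup A] (e : H ≃+ (M ⧸ Submodule.span ℤ (Set.range v)))
    (h : Subsingleton (ExtOne H A)) (a : ι → A) : ∃ g : M →ₗ[ℤ] A, ∀ i, g (v i) = a i := by
  let b := Module.Basis.span hv
  obtain ⟨g, hg⟩ := exists_extension_of_subsingleton_extOne_of_small _ e h (b.constr ℤ a)
  refine ⟨g, fun i => ?_⟩
  have hgi := (LinearMap.congr_fun hg (b i)).trans (b.constr_basis ℤ a i)
  rwa [Module.Basis.span_apply] at hgi

theorem exists_int_hom_of_coe_eq_zero {D : Type*} [AddCommGroup D] {ψ : D →+ ℚ}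
    (hψ : ∀ d, (ψ d : AddCircle (1 : ℚ)) = 0) : ∃ φ : D →+ ℤ, ∀ d, (φ d : ℚ) = ψ d := by
  have hint : ∀ d, ∃ k : ℤ, (k : ℚ) = ψ d := fun d => by
    simpa using (AddCircle.coe_eq_zero_iff (1 : ℚ)).1 (hψ d)
  choose k hk using hint
  exact ⟨AddMonoidHom.mk' k fun x y => Int.cast_injective (α := ℚ) (by simp [hk]), hk⟩

/-- Every homomorphism to `ℚ / ℤ` lifts to `ℚ`. Since `ℤ → ℚ → ℚ / ℤ` is an injective resolution,
this is `Ext(D, ℤ) = 0`, in a form which makes sense in every universe. -/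
def LiftsCharacters (D : Type*) [AddCommGroup D] : Prop :=
  ∀ χ : D →+ AddCircle (1 : ℚ), ∃ ψ : D →+ ℚ, ∀ d, (ψ d : AddCircle (1 : ℚ)) = χ d

theorem IsWhitehead.liftsCharacters {A : Type u} [AddCommGroup A] (hA : IsWhitehead A) :
    LiftsCharacters A := by
  intro χ
  let i : ULift.{u} ℤ →ₗ[ℤ] ULift.{u} ℚ := (AddEquiv.ulift.symm.toAddMonoidHom.comp
    ((Int.castAddHom ℚ).comp AddEquiv.ulift.toAddMonoidHom)).toIntLinearMap
  let p : ULift.{u} ℚ →ₗ[ℤ] ULift.{u} (AddCircle (1 : ℚ)) :=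
    (AddEquiv.ulift.symm.toAddMonoidHom.comp
      ((QuotientAddGroup.mk' _).comp AddEquiv.ulift.toAddMonoidHom)).toIntLinearMap
  have hi : Function.Injective i :=
    ULift.up_injective.comp (Int.cast_injective.comp ULift.down_injective)
  have hp : Function.Surjective p :=
    ULift.up_surjective.comp ((QuotientAddGroup.mk'_surjective _).comp ULift.down_surjective)
  have hip : Function.Exact i p := fun ⟨q⟩ => by
    have hpq : p ⟨q⟩ = 0 ↔ (q : AddCircle (1 : ℚ)) = 0 := ULift.down_injective.eq_iff.symm
    rw [hpq, AddCircle.coe_eq_zero_iff]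
    exact ⟨fun ⟨n, hn⟩ => ⟨⟨n⟩, congrArg ULift.up ((zsmul_one n).symm.trans hn)⟩,
      fun ⟨⟨n⟩, hn⟩ => ⟨n, (zsmul_one n).trans (congrArg ULift.down hn)⟩⟩
  obtain ⟨g, hg⟩ := exists_lift_of_subsingleton_extOne hi hp hip hA
    (AddEquiv.ulift.symm.toAddMonoidHom.comp χ).toIntLinearMap
  refine ⟨AddEquiv.ulift.toAddMonoidHom.comp g.toAddMonoidHom, fun d => ?_⟩
  exact congrArg ULift.down (LinearMap.congr_fun hg d)

section LiftsCharacters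

variable {C D : Type*} [AddCommGroup C] [AddCommGroup D]

theorem exists_character_extension {f : C →+ D} (hf : Function.Injective f)
    (χ : C →+ AddCircle (1 : ℚ)) : ∃ χ' : D →+ AddCircle (1 : ℚ), ∀ c, χ' (f c) = χ c := by
  obtain ⟨χ', h⟩ := CharacterModule.dual_surjective_of_injective (R := ℤ) f.toIntLinearMap hf χ
  exact ⟨χ', DFunLike.congr_fun h⟩

theorem exists_character_of_notMem {N : AddSubgroup D} {g : D} (hg : g ∉ N) :
    ∃ χ : D →+ AddCircle (1 : ℚ), (∀ d ∈ N, χ d = 0) ∧ χ g ≠ 0 := by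
  obtain ⟨χ, hχ⟩ := CharacterModule.exists_character_apply_ne_zero_of_ne_zero
    (a := (g : D ⧸ N)) (by rwa [Ne, QuotientAddGroup.eq_zero_iff])
  refine ⟨AddMonoidHom.comp χ (QuotientAddGroup.mk' N), fun d hd => ?_, hχ⟩
  exact (congrArg χ ((QuotientAddGroup.eq_zero_iff d).2 hd)).trans (map_zero χ)

theorem eq_zero_of_forall_pow_dvd {p k : ℤ} (hp : p.natAbs ≠ 1) (h : ∀ n : ℕ, p ^ n ∣ k) :
    k = 0 := by
  by_contra hk
  obtain ⟨n, hn⟩ := Int.finiteMultiplicity_iff.2 ⟨hp, hk⟩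
  exact hn (h (n + 1))

theorem LiftsCharacters.eq_zero_of_zsmul_eq_zero (hD : LiftsCharacters D) {n : ℤ} (hn : n ≠ 0)
    {d : D} (hd : n • d = 0) : d = 0 := by
  by_contra hd0
  obtain ⟨χ, -, hχ⟩ := exists_character_of_notMem (N := ⊥) (g := d) (by simpa using hd0)
  obtain ⟨ψ, hψ⟩ := hD χ
  have hψd : ψ d = 0 := by
    simpa [hn] using (map_zsmul ψ n d).symm.trans ((congrArg ψ hd).trans (map_zero ψ))
  exact hχ (by rw [← hψ, hψd, AddCircle.coe_zero])

theorem LiftsCharacters.exists_int_hom_of_not_dvd (hD : LiftsCharacters D) {n : ℕ}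
    (hn : n ≠ 0) {g : D} (hg : ∀ d : D, n • d ≠ g) : ∃ φ : D →+ ℤ, φ g ≠ 0 := by
  obtain ⟨χ, hχ, hχg⟩ := exists_character_of_notMem (N := (nsmulAddMonoidHom n : D →+ D).range)
    (g := g) (by rintro ⟨d, hd⟩; exact hg d hd)
  obtain ⟨ψ, hψ⟩ := hD χ
  obtain ⟨φ, hφ⟩ := exists_int_hom_of_coe_eq_zero (ψ := n • ψ) fun d => by
    rw [AddMonoidHom.nsmul_apply, ← map_nsmul, hψ]
    exact hχ _ ⟨d, rfl⟩
  refine ⟨φ, fun hφg => hχg ?_⟩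
  have hψg : ψ g = 0 := by simpa [hφg, hn] using (hφ g).symm
  rw [← hψ, hψg, AddCircle.coe_zero]

theorem LiftsCharacters.exists_forall_nsmul_ne (hD : LiftsCharacters D) {g : D} (hg : g ≠ 0) :
    ∃ n : ℕ, n ≠ 0 ∧ ∀ d : D, n • d ≠ g := by
  -- If `g` were divisible, then a character that kills all `d` with `2 ^ k • d ∈ ℤ g`, but not
  -- some `d` with `3 • d = g`, would lift to a `ψ` for which `ψ g` is an integer divisible by all
  -- powers of `2`.
  by_contra! hdiv
  let N : AddSubgroup D :=
    { carrier := {d | ∃ k : ℕ, ∃ n : ℤ, (2 : ℤ) ^ k • d = n • g}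
      zero_mem' := ⟨0, 0, by simp⟩
      add_mem' := by
        rintro d e ⟨k, n, hd⟩ ⟨l, m, he⟩
        refine ⟨k + l, 2 ^ l * n + 2 ^ k * m, ?_⟩
        rw [smul_add, add_smul, mul_smul, mul_smul, ← hd, ← he, smul_smul, smul_smul]
        ring_nf
      neg_mem' := by
        rintro d ⟨k, n, hd⟩
        exact ⟨k, -n, by rw [smul_neg, hd, neg_smul]⟩ }
  obtain ⟨d, hd⟩ := hdiv 3 (by norm_num)
  have hdN : d ∉ N := by
    rintro ⟨k, n, hkn⟩
    have h0 : (2 ^ k - n * 3) • d = 0 := by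
      rw [sub_smul, hkn, ← hd, mul_smul, sub_eq_zero, ofNat_zsmul]
    have hd0 : d = 0 := hD.eq_zero_of_zsmul_eq_zero (sub_ne_zero.2 fun h => absurd
      (Int.prime_three.dvd_of_dvd_pow (Dvd.intro_left n h.symm)) (by norm_num)) h0
    exact hg (by rw [← hd, hd0, smul_zero])
  obtain ⟨χ, hχN, hχd⟩ := exists_character_of_notMem hdN
  obtain ⟨ψ, hψ⟩ := hD χ
  obtain ⟨φ, hφ⟩ := exists_int_hom_of_coe_eq_zero (ψ := ψ.comp N.subtype) fun c =>
    (hψ c).trans (hχN c c.2)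
  have hgN : g ∈ N := ⟨0, 1, by simp⟩
  have hφg : φ ⟨g, hgN⟩ = 0 := by
    refine eq_zero_of_forall_pow_dvd (p := 2) (by decide) fun k => ?_
    obtain ⟨c, hc⟩ := hdiv (2 ^ k) (by positivity)
    have hcN : c ∈ N := ⟨k, 1, by rw [← hc, one_smul, ← natCast_zsmul, Nat.cast_pow]; rfl⟩
    refine ⟨φ ⟨c, hcN⟩, ?_⟩
    have hgc : (⟨g, hgN⟩ : N) = 2 ^ k • ⟨c, hcN⟩ := Subtype.ext hc.symm
    rw [hgc, map_nsmul, nsmul_eq_mul, Nat.cast_pow, Nat.cast_ofNat]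
  have hψd : ψ d = 0 := by
    have hψg : ψ g = 0 := (hφ ⟨g, hgN⟩).symm.trans (by rw [hφg, Int.cast_zero])
    simpa [← hd] using hψg
  exact hχd (by rw [← hψ, hψd, AddCircle.coe_zero])

theorem LiftsCharacters.exists_int_hom_apply_ne_zero (hD : LiftsCharacters D) {g : D}
    (hg : g ≠ 0) : ∃ φ : D →+ ℤ, φ g ≠ 0 := by
  obtain ⟨n, hn, hng⟩ := hD.exists_forall_nsmul_ne hg
  exact hD.exists_int_hom_of_not_dvd hn hng

end LiftsCharacters

section Cardinality

variable {A : Type u} {μ : Cardinal.{u}}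

theorem mk_addSubgroup_closure_le [AddCommGroup A] (hμ : ℵ₀ ≤ μ) {s : Set A} (hs : #s ≤ μ) :
    #(AddSubgroup.closure s) ≤ μ := by
  have hsurj : (AddSubgroup.closure s : Set A) ⊆
      range (Finsupp.linearCombination ℤ ((↑) : s → A)) := by
    intro x hx
    rw [← AddSubgroup.coe_toIntSubmodule, AddSubgroup.toIntSubmodule_closure, SetLike.mem_coe,
      Finsupp.mem_span_iff_linearCombination] at hx
    exact hx
  refine (mk_le_mk_of_subset hsurj).trans (mk_range_le.trans ?_)
  cases isEmpty_or_nonempty s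
  · exact (mk_le_aleph0 (α := s →₀ ℤ)).trans hμ
  · rw [mk_finsupp_lift_of_infinite', lift_uzero, mk_int, lift_aleph0]
    exact max_le hs hμ

theorem mk_union_le_of_le (hμ : ℵ₀ ≤ μ) {s t : Set A} (hs : #s ≤ μ) (ht : #t ≤ μ) :
    #(s ∪ t : Set A) ≤ μ :=
  (mk_union_le s t).trans (add_le_of_le hμ hs ht)

theorem mk_iUnion_le_of_le (hμ : ℵ₀ ≤ μ) {ι : Type u} (hι : #ι ≤ μ) {s : ι → Set A}
    (hs : ∀ i, #(s i) ≤ μ) : #(⋃ i, s i) ≤ μ :=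
  (mk_iUnion_le s).trans ((mul_le_mul' hι (ciSup_le' hs)).trans (mul_eq_self hμ).le)

theorem mk_fun_rat_le {X : Type u} (hμ : ℵ₀ ≤ μ) (hX : #X ≤ μ) : #(X → ℚ) ≤ 2 ^ μ := by
  rw [mk_arrow, Cardinal.mkRat, lift_aleph0, lift_uzero]
  calc ℵ₀ ^ #X ≤ ℵ₀ ^ μ := power_le_power_left aleph0_ne_zero hX
    _ = 2 ^ μ := power_eq_two_power hμ (ofNat_le_aleph0 (n := 2)) hμ

theorem mk_range_le_of_subset_Iio_ord (hμ : ℵ₀ ≤ μ) {E : Set Ordinal.{u}}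
    (hE : E ⊆ Iio μ.ord) (f : E × ℕ → A) : #(range f) ≤ μ := by
  have hlift : ℵ₀ ≤ lift.{u + 1} μ := aleph0_le_lift.2 hμ
  have hEμ : #E ≤ lift.{u + 1} μ :=
    (mk_le_mk_of_subset hE).trans_eq (by rw [mk_Iio_ordinal, card_ord])
  have hrange := mk_range_le_lift (f := f)
  rw [lift_id'.{u, u + 1}, mk_prod, lift_uzero, mk_nat, lift_aleph0] at hrange
  exact lift_le.{u + 1}.1 (hrange.trans ((mul_le_mul' hEμ hlift).trans (mul_eq_self hlift).le))

theorem exists_injective_lt_ord (hA : #A = μ) :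
    ∃ idx : A → Ordinal.{u}, Function.Injective idx ∧ ∀ a, idx a < μ.ord := by
  obtain ⟨e⟩ := Cardinal.eq.1 (hA.trans (mk_ord_toType μ).symm)
  let idx : A → Iio μ.ord := Ordinal.ToType.mk.symm ∘ e
  exact ⟨fun a => idx a, Subtype.val_injective.comp
    (Ordinal.ToType.mk.symm.injective.comp e.injective), fun a => (idx a).2⟩

theorem mk_setOf_lt_le_card {idx : A → Ordinal.{u}} (hidx : Function.Injective idx)
    (δ : Ordinal.{u}) : #{a | idx a < δ} ≤ δ.card := by
  have hle := lift_mk_le_lift_mk_of_injective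
    (f := fun a : {a | idx a < δ} => (⟨idx a, a.2⟩ : Iio δ))
    fun a a' h => Subtype.ext (hidx (congrArg Subtype.val h))
  rwa [mk_Iio_ordinal, lift_id'.{u, u + 1}, Cardinal.lift_le] at hle

end Cardinality

/-- The counting argument of the weak diamond. -/
theorem two_power_mk_le_of_determined {L : Type u} [Preorder L] [WellFoundedLT L]
    {μ : Cardinal.{u}} (hμ : ℵ₀ ≤ μ) {R₀ : Type u} {R : L → Type u} (hR₀ : #R₀ ≤ 2 ^ μ)
    (hR : ∀ α, #(R α) ≤ 2 ^ μ) (r₀ : (L → Bool) → R₀) (r : ∀ α, (L → Bool) → R α)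
    (h : ∀ α η η', r₀ η = r₀ η' → (∀ β < α, η β = η' β ∧ r β η = r β η') → η α = η' α) :
    (2 : Cardinal.{u}) ^ #L ≤ 2 ^ μ := by
  let I := μ.out
  have hI : #I = μ := mk_out μ
  have hcode : ∀ α, Nonempty (R α ↪ (I → Bool)) := fun α => by
    rw [← le_def, mk_arrow I, mk_bool, lift_two, lift_uzero, hI]
    exact hR α
  let code := fun α => (hcode α).some
  -- The value of `T η s` at `α` codes, in terms of `i`, the data that `r` attaches to the
  -- functions `T η (i :: s)`; hence `η` can be recovered by recursion on `α` from the values of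
  -- `r₀` at the functions `T η s`.
  let T : (L → Bool) → List I → L → Bool := fun η s =>
    s.foldr (fun i η' α => code α (r α η') i) η
  have hinj : Function.Injective fun η s => r₀ (T η s) := by
    intro η η' hr₀
    have key : ∀ α s, T η s α = T η' s α ∧ r α (T η s) = r α (T η' s) := by
      intro α
      induction α using WellFoundedLT.induction with
      | ind α ih =>
        have hT : ∀ s, T η s α = T η' s α := fun s =>
          h α _ _ (congrFun hr₀ s) fun β hβ => ih β hβ s
        exact fun s => ⟨hT s, (code α).injective (funext fun i => hT (i :: s))⟩
    exact funext fun α => (key α []).1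
  have hlist : #(List I) ≤ μ := (mk_list_le_max I).trans (max_le hμ hI.le)
  calc (2 : Cardinal.{u}) ^ #L = #(L → Bool) := by simp
    _ ≤ #(List I → R₀) := mk_le_of_injective hinj
    _ = #R₀ ^ #(List I) := by simp
    _ ≤ (2 ^ μ) ^ μ := (power_le_power_right hR₀).trans
      (power_le_power_left (power_ne_zero μ two_ne_zero) hlist)
    _ = 2 ^ μ := by rw [← power_mul, mul_eq_self hμ]

section Quotients

variable {A : Type u} [AddCommGroup A] {μ : Cardinal.{u}}

theorem exists_addCircle_sum (L : Type*) [DecidableEq L] :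
    ∃ σ : (L → AddCircle (1 : ℚ)) →+ AddCircle (1 : ℚ), ∀ α c, σ (Pi.single α c) = c := by
  obtain ⟨σ, hσ⟩ := exists_character_extension
    (f := (Finsupp.coeFnAddHom : (L →₀ AddCircle (1 : ℚ)) →+ L → AddCircle (1 : ℚ)))
    DFunLike.coe_injective (Finsupp.liftAddHom fun _ => AddMonoidHom.id _)
  refine ⟨σ, fun α c => ?_⟩
  rw [← Finsupp.single_eq_pi_single]
  exact (hσ _).trans (Finsupp.liftAddHom_apply_single _ _ _)

/-- The witness `Φ η` is the sum of the `χ α` with `η α = true`, where infinite sums are understood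
by means of an extension of the finite sums. -/
theorem exists_switched_characters {L : Type*} [LinearOrder L]
    (χ : L → A →+ AddCircle (1 : ℚ)) :
    ∃ Φ : (L → Bool) → A →+ AddCircle (1 : ℚ), ∀ η η' α x, (∀ β < α, η β = η' β) →
      η α = true → η' α = false → (∀ β > α, χ β x = 0) → Φ η x - Φ η' x = χ α x := by
  obtain ⟨σ, hσ⟩ := exists_addCircle_sum L
  refine ⟨fun η => σ.comp (AddMonoidHom.pi fun α => if η α then χ α else 0), ?_⟩
  intro η η' α x hlt hα hα' hgt
  rw [AddMonoidHom.comp_apply, AddMonoidHom.comp_apply, ← map_sub, ← hσ α (χ α x)]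
  refine congrArg σ (funext fun β => ?_)
  change (if η β then χ β else 0) x - (if η' β then χ β else 0) x =
    (Pi.single α (χ α x) : L → AddCircle (1 : ℚ)) β
  rcases lt_trichotomy β α with h | rfl | h
  · simp [hlt β h, h.ne]
  · simp [hα, hα']
  · cases hβ : η β <;> cases hβ' : η' β <;> simp [hgt β h, h.ne']

theorem exists_obstruction_of_not_liftsCharacters {P : AddSubgroup A}
    {D : AddSubgroup (A ⧸ P)} (hD : #D ≤ μ) (hDL : ¬ LiftsCharacters D) :
    ∃ (X : Set A) (χ : A →+ AddCircle (1 : ℚ)), #X ≤ μ ∧ (∀ x ∈ P, χ x = 0) ∧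
      ∀ ψ : A →+ ℚ, (∀ x ∈ P, ψ x = 0) → ∃ x ∈ X, (ψ x : AddCircle (1 : ℚ)) ≠ χ x := by
  unfold LiftsCharacters at hDL
  push Not at hDL
  obtain ⟨χ₀, hχ₀⟩ := hDL
  obtain ⟨χ₁, hχ₁⟩ := exists_character_extension (f := D.subtype) D.subtype_injective χ₀
  refine ⟨range fun d : D => (d : A ⧸ P).out, χ₁.comp (QuotientAddGroup.mk' P),
    mk_range_le.trans hD, fun x hx => ?_, fun ψ hψ => ?_⟩
  · exact (congrArg χ₁ ((QuotientAddGroup.eq_zero_iff x).2 hx)).trans (map_zero χ₁)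
  · obtain ⟨d, hd⟩ := hχ₀ ((QuotientAddGroup.lift P ψ hψ).comp D.subtype)
    have hout : (((d : A ⧸ P).out : A) : A ⧸ P) = d := QuotientAddGroup.out_eq' _
    refine ⟨_, ⟨d, rfl⟩, fun h => hd ?_⟩
    rw [← hχ₁, AddMonoidHom.comp_apply, D.subtype_apply, ← hout]
    exact h

/-- A weak diamond type argument: every `η : L → Bool` defines a character of `A`, in which the
`α`-th obstruction is switched on or off according to `η α`. By the choice of the obstructions, a
lift of this character determines `η` recursively from its values on small sets. -/
theorem LiftsCharacters.two_power_mk_le (hA : LiftsCharacters A) (hμ : ℵ₀ ≤ μ)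
    {L : Type u} [LinearOrder L] [WellFoundedLT L] {B : Set A} (hB : #B ≤ μ)
    {X : L → Set A} (hX : ∀ α, #(X α) ≤ μ) {χ : L → A →+ AddCircle (1 : ℚ)}
    (hχ : ∀ α, ∀ x ∈ AddSubgroup.closure (B ∪ ⋃ β : Iio α, X β), χ α x = 0)
    (hobs : ∀ α, ∀ ψ : A →+ ℚ, (∀ x ∈ AddSubgroup.closure (B ∪ ⋃ β : Iio α, X β), ψ x = 0) →
      ∃ x ∈ X α, (ψ x : AddCircle (1 : ℚ)) ≠ χ α x) :
    (2 : Cardinal.{u}) ^ #L ≤ 2 ^ μ := by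
  obtain ⟨Φ, hΦ⟩ := exists_switched_characters χ
  choose g hg using fun η => hA (Φ η)
  have key : ∀ {η η' α}, (∀ β < α, η β = η' β) →
      (∀ x ∈ AddSubgroup.closure (B ∪ ⋃ β : Iio α, X β), g η x = g η' x) →
      η α = true → η' α ≠ false := by
    intro η η' α hlt hP hα hα'
    obtain ⟨x, hx, hne⟩ := hobs α (g η - g η') fun x hx => by simp [hP x hx]
    refine hne ?_
    rw [AddMonoidHom.sub_apply, AddCircle.coe_sub, hg, hg, hΦ η η' α x hlt hα hα' fun β hβ => ?_]
    exact hχ β x (AddSubgroup.subset_closure (Or.inr (mem_iUnion.2 ⟨⟨α, hβ⟩, hx⟩)))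
  refine two_power_mk_le_of_determined hμ (mk_fun_rat_le hμ hB)
    (fun α => mk_fun_rat_le hμ (hX α)) (fun η x => g η x) (fun α η x => g η x) ?_
  intro α η η' hr₀ hr
  have hP : ∀ x ∈ AddSubgroup.closure (B ∪ ⋃ β : Iio α, X β), g η x = g η' x := by
    refine AddMonoidHom.eqOn_closure ?_
    rintro x (hx | hx)
    · exact congrFun hr₀ ⟨x, hx⟩
    · obtain ⟨β, hβ⟩ := mem_iUnion.1 hx
      exact congrFun (hr β β.2).2 ⟨x, hβ⟩
  cases h : η α <;> cases h' : η' α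
  · rfl
  · exact (key (fun β hβ => (hr β hβ).1.symm) (fun x hx => (hP x hx).symm) h' h).elim
  · exact (key (fun β hβ => (hr β hβ).1) hP h h').elim
  · rfl

theorem LiftsCharacters.exists_quotient_forall_liftsCharacters (hA : LiftsCharacters A)
    (hμ : ℵ₀ ≤ μ) (hpow : (2 : Cardinal.{u}) ^ μ < 2 ^ Order.succ μ) {B : AddSubgroup A}
    (hB : #B ≤ μ) :
    ∃ P : AddSubgroup A, B ≤ P ∧ #P ≤ μ ∧
      ∀ D : AddSubgroup (A ⧸ P), #D ≤ μ → LiftsCharacters D := by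
  by_contra! hcon
  have hex : ∀ P : AddSubgroup A, B ≤ P → #P ≤ μ →
      ∃ (X : Set A) (χ : A →+ AddCircle (1 : ℚ)), #X ≤ μ ∧ (∀ x ∈ P, χ x = 0) ∧
        ∀ ψ : A →+ ℚ, (∀ x ∈ P, ψ x = 0) → ∃ x ∈ X, (ψ x : AddCircle (1 : ℚ)) ≠ χ x := by
    intro P hBP hP
    obtain ⟨D, hD, hDL⟩ := hcon P hBP hP
    exact exists_obstruction_of_not_liftsCharacters hD hDL
  choose! X χ hX hχ hobs using hex
  let L := (Order.succ μ).ord.ToType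
  have hL : #L = Order.succ μ := mk_ord_toType _
  have hIio : ∀ α : L, #(Iio α) ≤ μ := fun α => by
    rw [← Order.lt_succ_iff]
    simpa only [hL] using mk_Iio_lt α (by rw [hL, Ordinal.type_toType])
  let Y : L → Set A := wellFounded_lt.fix fun α F =>
    X (AddSubgroup.closure (B ∪ ⋃ β : Iio α, F β β.2))
  let P : L → AddSubgroup A := fun α => AddSubgroup.closure ((B : Set A) ∪ ⋃ β : Iio α, Y β)
  have hY : ∀ α, Y α = X (P α) := fun α => wellFounded_lt.fix_eq _ _
  have hBP : ∀ α, B ≤ P α := fun α x hx => AddSubgroup.subset_closure (Or.inl hx)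
  have hP : ∀ α, (∀ β < α, #(Y β) ≤ μ) → #(P α) ≤ μ := fun α hYα =>
    mk_addSubgroup_closure_le hμ
      (mk_union_le_of_le hμ hB (mk_iUnion_le_of_le hμ (hIio α) fun β => hYα β β.2))
  have hYμ : ∀ α, #(Y α) ≤ μ := fun α => by
    induction α using WellFoundedLT.induction with
    | ind α ih => exact hY α ▸ hX _ (hBP α) (hP α ih)
  have hPμ : ∀ α, #(P α) ≤ μ := fun α => hP α fun β _ => hYμ β
  refine hpow.not_ge (hL ▸ hA.two_power_mk_le hμ (L := L) hB hYμ
    (fun α => hχ _ (hBP α) (hPμ α)) fun α => ?_)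
  exact hY α ▸ hobs _ (hBP α) (hPμ α)

end Quotients

section IntegerEquations

theorem eq_zero_of_two_mul_eq_add {c d : ℕ → ℤ} {m : ℤ} (hd0 : d 0 = 0) (hc0 : Odd (c 0))
    (hd : ∀ n, 2 * d (n + 1) = d n + c n * m) : m = 0 := by
  have key : ∀ n : ℕ, ∃ o : ℤ, Odd o ∧ 2 ^ (n + 1) * d (n + 1) = m * o := by
    intro n
    induction n with
    | zero => exact ⟨c 0, hc0, by linear_combination hd 0 + hd0⟩
    | succ n ih =>
      obtain ⟨o, ho, h⟩ := ih
      refine ⟨o + 2 ^ (n + 1) * c (n + 1),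
        ho.add_even ((even_two.pow_of_ne_zero n.succ_ne_zero).mul_right _), ?_⟩
      linear_combination 2 ^ (n + 1) * hd (n + 1) + h
  refine eq_zero_of_forall_pow_dvd (p := 2) (by norm_num) fun n => ?_
  obtain ⟨o, ho, h⟩ := key n
  exact (pow_dvd_pow 2 n.le_succ).trans
    (IsCoprime.dvd_of_dvd_mul_right (Int.isCoprime_two_left.2 ho).pow_left ⟨_, h.symm⟩)

theorem eq_of_two_mul_sub_eq_add {z y y' : ℕ → ℤ} {b b' : ℕ → Bool} {m : ℤ} (hm : m ≠ 0)
    (h0 : y 0 = y' 0) (hy : ∀ n, 2 * y (n + 1) - y n = z n + (b n).toNat * m)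
    (hy' : ∀ n, 2 * y' (n + 1) - y' n = z n + (b' n).toNat * m) : b = b' := by
  have hbit : ∀ n, y n = y' n → b n = b' n := by
    intro n hn
    by_contra hne
    refine hm (eq_zero_of_two_mul_eq_add (d := fun k => y (n + k) - y' (n + k))
      (c := fun k => (b (n + k)).toNat - (b' (n + k)).toNat) (sub_eq_zero.2 hn) ?_ fun k => ?_)
    · simp only [add_zero]
      revert hne
      cases b n <;> cases b' n <;> simp
    · linear_combination hy (n + k) - hy' (n + k)
  have heq : ∀ n, y n = y' n := by
    intro n
    induction n with
    | zero => exact h0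
    | succ n ih =>
      have h := hy n
      rw [hbit n ih] at h
      linarith [hy' n]
  exact funext fun n => hbit n (heq n)

/-- Two binary sequences `ε` that are solvable with the same `m` and `y 0` coincide, and there are
uncountably many binary sequences. -/
theorem exists_forall_ne_two_mul_sub (z : ℕ → ℤ) : ∃ ε : ℕ → ℤ, ∀ m : ℤ, m ≠ 0 → ∀ y : ℕ → ℤ,
    ¬ ∀ n, 2 * y (n + 1) - y n = z n + ε n * m := by
  by_contra! hcon
  choose m hm y hy using fun b : ℕ → Bool => hcon fun n => (b n).toNat
  have hinj : Function.Injective fun b => (m b, y b 0) := by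
    intro b b' h
    obtain ⟨hmb, hy0⟩ := Prod.mk.inj h
    exact eq_of_two_mul_sub_eq_add (hm b) hy0 (hy b) (hmb ▸ hy b')
  have hcount : #(ℕ → Bool) ≤ ℵ₀ := mk_le_aleph0_iff.2 hinj.countable
  rw [← power_def, mk_bool, mk_nat, two_power_aleph0] at hcount
  exact aleph0_lt_continuum.not_ge hcount

end IntegerEquations

section Stationary

variable {κ : Cardinal.{u}}

theorem isClub_closed_under (hκ : κ.IsRegular) (hκ' : ℵ₀ < κ) {f : Ordinal.{u} → Ordinal.{u}}
    (hf : ∀ β < κ.ord, f β < κ.ord) : IsClub {a : Iio κ.ord | ∀ β < (a : Ordinal), f β < a} := by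
  constructor
  · intro s hs _ _ a ha β hβ
    obtain ⟨b, hb, hβb⟩ := (lt_isLUB_iff (b := ⟨β, hβ.trans a.2⟩) ha).1 hβ
    exact (hs hb β hβb).trans_le (ha.1 hb)
  · intro a
    let g : Ordinal.{u} → Ordinal.{u} := fun a => max a (⨆ β : Iio a, f β + 1)
    have hg : ∀ a < κ.ord, g a < κ.ord := fun a ha => by
      refine max_lt ha (Ordinal.lift_iSup_add_one_lt_of_lt_cof ?_ fun β => hf _ (β.2.trans ha))
      rw [mk_Iio_ordinal, ← Ordinal.lift_cof, hκ.cof_ord, lift_lift, lift_lt]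
      exact lt_ord.1 ha
    refine ⟨⟨Ordinal.nfp g a, nfp_lt_ord_of_isRegular hκ hκ'.ne' hg a.2⟩, fun β hβ => ?_,
      Ordinal.le_nfp g a⟩
    obtain ⟨n, hn⟩ := Ordinal.lt_nfp_iff.1 hβ
    calc f β < f β + 1 := Order.lt_add_one_iff.2 le_rfl
      _ ≤ ⨆ β : Iio (g^[n] a), f β + 1 :=
        Ordinal.le_iSup (fun β : Iio (g^[n] a) => f β + 1) ⟨β, hn⟩
      _ ≤ g^[n + 1] a := by
        rw [Function.iterate_succ_apply']
        exact le_max_right _ _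
      _ ≤ Ordinal.nfp g a := Ordinal.iterate_le_nfp g a (n + 1)

theorem IsStationaryIn.exists_closed_under {X : Set Ordinal.{u}} (hX : IsStationaryIn κ X)
    (hκ : κ.IsRegular) (hκ' : ℵ₀ < κ) {f : Ordinal.{u} → Ordinal.{u}}
    (hf : ∀ β < κ.ord, f β < κ.ord) : ∃ a ∈ X, a < κ.ord ∧ ∀ β < a, f β < a := by
  obtain ⟨a, ha, hcl⟩ := hX (isClub_closed_under hκ hκ' hf)
  exact ⟨a, ha, a.2, hcl⟩

theorem omega0_mul_add_natCast_inj {j j' : Ordinal.{u}} {n n' : ℕ} :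
    Ordinal.omega0 * j + n = Ordinal.omega0 * j' + n' ↔ j = j' ∧ n = n' := by
  refine ⟨fun h => ?_, by rintro ⟨rfl, rfl⟩; rfl⟩
  have hdiv := congrArg (· / Ordinal.omega0) h
  have hmod := congrArg (· % Ordinal.omega0) h
  simp only [Ordinal.mul_add_div _ Ordinal.omega0_ne_zero, Ordinal.mul_add_mod_self,
    Ordinal.div_eq_zero_of_lt (Ordinal.natCast_lt_omega0 _),
    Ordinal.mod_eq_of_lt (Ordinal.natCast_lt_omega0 _), add_zero, Nat.cast_inj] at hdiv hmod
  exact ⟨hdiv, hmod⟩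

/-- The graph of `z` is coded by the set of ordinals `ω * j + e (z j)`, where `e` enumerates `Y`. -/
theorem Diamond.exists_guess {E : Set Ordinal.{u}} (h : Diamond κ E) (hκ : κ.IsRegular)
    (hκ' : ℵ₀ < κ) (Y : Type v) [Countable Y] [Nonempty Y] :
    ∃ G : Ordinal.{u} → Ordinal.{u} → Y, ∀ z : Ordinal.{u} → Y, ∃ ν ∈ E,
      ∀ j < ν, G ν j = z j := by
  obtain ⟨D, hD⟩ := h
  obtain ⟨e, he⟩ := exists_injective_nat Y
  let code : Ordinal.{u} → Y → Ordinal.{u} := fun j i => Ordinal.omega0 * j + e i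
  refine ⟨fun ν j => Classical.epsilon fun i => code j i ∈ D ν, fun z => ?_⟩
  have hlt : ∀ β < κ.ord, Ordinal.omega0 * β + Ordinal.omega0 < κ.ord := by
    intro β hβ
    rw [lt_ord] at hβ ⊢
    rw [Ordinal.card_add, Ordinal.card_mul, Ordinal.card_omega0]
    exact add_lt_of_lt hκ.aleph0_le (mul_lt_of_lt hκ.aleph0_le hκ' hβ) hκ'
  obtain ⟨ν, ⟨hνE, hν⟩, -, hcl⟩ :=
    (hD {α | ∃ j, α = code j (z j)}).exists_closed_under hκ hκ' hlt
  refine ⟨ν, hνE, fun j hj => ?_⟩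
  have hmem : ∀ i, code j i ∈ D ν ↔ i = z j := by
    intro i
    rw [← hν]
    constructor
    · rintro ⟨⟨j', hj'⟩, -⟩
      obtain ⟨rfl, hi⟩ := omega0_mul_add_natCast_inj.1 hj'
      exact he hi
    · rintro rfl
      exact ⟨⟨j, rfl⟩, (add_le_add_right (Ordinal.natCast_lt_omega0 _).le _).trans_lt (hcl j hj)⟩
  exact (hmem _).1 (Classical.epsilon_spec (p := fun i => code j i ∈ D ν) ⟨z j, (hmem _).2 rfl⟩)

end Stationary

section Solvable

open Classical in
/-- The equations `2 y_{ν,n+1} - y_{ν,n} - z_{ζ_ν(n)} = c_{ν,n}` (`ν ∈ E`, `n ∈ ω`) have a solution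
in `C`. For `c = a_δ` these are the equations which the generators `w_{δ,ν,n}` with a fixed `δ`
impose modulo the `x_β`; as there, the terms `z_{ζ_ν(n)}` are omitted if `σ` is countable. -/
def Solvable (σ : Cardinal.{u}) (E : Set Ordinal.{u}) (ζ : Ordinal.{u} → ℕ → Ordinal.{u})
    {C : Type v} [AddCommGroup C] (c : Ordinal.{u} → ℕ → C) : Prop :=
  ∃ (y : Ordinal.{u} → ℕ → C) (z : Ordinal.{u} → C), ∀ ν ∈ E, ∀ n,
    2 • y ν (n + 1) - y ν n - (if ℵ₀ < σ then z (ζ ν n) else 0) = c ν n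

variable {σ : Cardinal.{u}} {E : Set Ordinal.{u}} {ζ : Ordinal.{u} → ℕ → Ordinal.{u}}

theorem Solvable.map {C D : Type*} [AddCommGroup C] [AddCommGroup D] {c : Ordinal.{u} → ℕ → C}
    (h : Solvable σ E ζ c) (f : C →+ D) : Solvable σ E ζ fun ν n => f (c ν n) := by
  obtain ⟨y, z, hyz⟩ := h
  refine ⟨fun ν n => f (y ν n), fun j => f (z j), fun ν hν n => ?_⟩
  simp only [← hyz ν hν n, map_sub, map_nsmul, apply_ite f, map_zero]

theorem Solvable.exists_addSubgroup {μ : Cardinal.{u}} (hμ : ℵ₀ ≤ μ) (hE : E ⊆ Iio μ.ord)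
    {C : Type u} [AddCommGroup C] {ε : Ordinal.{u} → ℕ → ℤ} {g : C}
    (h : Solvable σ E ζ fun ν n => ε ν n • g) :
    ∃ D : AddSubgroup C, #D ≤ μ ∧ ∃ g' : D, g' = g ∧ Solvable σ E ζ fun ν n => ε ν n • g' := by
  classical
  obtain ⟨y, z, hyz⟩ := h
  let Y : Set C := range fun p : E × ℕ => y p.1 p.2
  let Z : Set C := range fun p : E × ℕ => z (ζ p.1 p.2)
  let D := AddSubgroup.closure (Y ∪ (Z ∪ {g}))
  have hD : #D ≤ μ := mk_addSubgroup_closure_le hμ <|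
    mk_union_le_of_le hμ (mk_range_le_of_subset_Iio_ord hμ hE _) <|
      mk_union_le_of_le hμ (mk_range_le_of_subset_Iio_ord hμ hE _) <|
        (mk_singleton g).trans_le (one_le_aleph0.trans hμ)
  have hy : ∀ ν ∈ E, ∀ n, y ν n ∈ D := fun ν hν n =>
    AddSubgroup.subset_closure (Or.inl ⟨(⟨ν, hν⟩, n), rfl⟩)
  have hz : ∀ ν ∈ E, ∀ n, z (ζ ν n) ∈ D := fun ν hν n =>
    AddSubgroup.subset_closure (Or.inr (Or.inl ⟨(⟨ν, hν⟩, n), rfl⟩))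
  refine ⟨D, hD, ⟨g, AddSubgroup.subset_closure (Or.inr (Or.inr rfl))⟩, rfl,
    fun ν n => if h : y ν n ∈ D then ⟨_, h⟩ else 0, fun j => if h : z j ∈ D then ⟨_, h⟩ else 0,
    fun ν hν n => Subtype.ext (Eq.trans ?_ (hyz ν hν n))⟩
  simp only [dif_pos (hy ν hν _), dif_pos (hz ν hν n)]
  split_ifs <;> simp

theorem Diamond.exists_not_solvable_int (h : Diamond σ E) (hσ : σ.IsRegular) (hσ' : ℵ₀ < σ)
    (hζ : ∀ ν ∈ E, ∀ n, ζ ν n < ν) :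
    ∃ ε : Ordinal.{u} → ℕ → ℤ, ∀ m : ℤ, m ≠ 0 → ¬ Solvable σ E ζ fun ν n => ε ν n • m := by
  obtain ⟨G, hG⟩ := h.exists_guess hσ hσ' ℤ
  choose ε hε using fun ν => exists_forall_ne_two_mul_sub fun n => G ν (ζ ν n)
  refine ⟨ε, fun m hm ⟨y, z, hyz⟩ => ?_⟩
  obtain ⟨ν, hν, hz⟩ := hG z
  refine hε ν m hm (y ν) fun n => ?_
  have heq : 2 * y ν (n + 1) - y ν n - z (ζ ν n) = ε ν n * m := by
    simpa [hσ'] using hyz ν hν n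
  rw [hz _ (hζ ν hν n)]
  linear_combination heq

theorem exists_not_solvable_int_of_countable (hσ : ¬ ℵ₀ < σ) (hE : E.Nonempty) :
    ∃ ε : Ordinal.{u} → ℕ → ℤ, ∀ m : ℤ, m ≠ 0 → ¬ Solvable σ E ζ fun ν n => ε ν n • m := by
  obtain ⟨ε, hε⟩ := exists_forall_ne_two_mul_sub 0
  obtain ⟨ν, hν⟩ := hE
  refine ⟨fun _ => ε, fun m hm ⟨y, z, hyz⟩ => hε m hm (y ν) fun n => ?_⟩
  simpa [hσ] using hyz ν hν n

end Solvable

section LadderPair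

variable {μ : Cardinal.{u}} {S E : Set Ordinal.{u}} {η : Ordinal.{u} → Ordinal.{u} → Ordinal.{u}}
  {ζ : Ordinal.{u} → ℕ → Ordinal.{u}}

theorem isRegular_cof_ord (hμ : ℵ₀ ≤ μ) : μ.ord.cof.IsRegular :=
  isRegular_cof (isSuccLimit_ord hμ)

theorem IsLadderPair.E_eq (h : IsLadderPair μ S η E ζ) (hμ : ℵ₀ ≤ μ) (hσ : ¬ ℵ₀ < μ.ord.cof) :
    E = {0} :=
  h.E_countable ((isRegular_cof_ord hμ).aleph0_le.antisymm (not_lt.1 hσ)).symm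

theorem IsLadderPair.E_subset_Iio (h : IsLadderPair μ S η E ζ) (hμ : ℵ₀ ≤ μ) :
    E ⊆ Iio μ.ord.cof.ord := by
  by_cases hσ : ℵ₀ < μ.ord.cof
  · exact h.E_subset hσ
  · rw [h.E_eq hμ hσ]
    exact singleton_subset_iff.2 (isRegular_cof_ord hμ).ord_pos

theorem IsLadderPair.η_add_lt (h : IsLadderPair μ S η E ζ) (hμ : ℵ₀ ≤ μ) {δ ν : Ordinal.{u}}
    (hδ : δ ∈ S) (hν : ν ∈ E) (n : ℕ) : η δ (ν + n) < δ := by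
  have hσ := (isRegular_cof_ord hμ).aleph0_le
  refine h.ladder_η.lt δ hδ _ ?_
  rw [mem_Iio, lt_ord, Ordinal.card_add, Ordinal.card_nat]
  exact add_lt_of_lt hσ (lt_ord.1 (h.E_subset_Iio hμ hν)) (natCast_lt_aleph0.trans_le hσ)

theorem IsLadderPair.exists_not_solvable_int (h : IsLadderPair μ S η E ζ) (hμ : ℵ₀ ≤ μ)
    (hE : ℵ₀ < μ.ord.cof → Diamond μ.ord.cof E) :
    ∃ ε : Ordinal.{u} → ℕ → ℤ, ∀ m : ℤ, m ≠ 0 →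
      ¬ Solvable μ.ord.cof E ζ fun ν n => ε ν n • m := by
  by_cases hσ : ℵ₀ < μ.ord.cof
  · exact (hE hσ).exists_not_solvable_int (isRegular_cof_ord hμ) hσ fun ν hν n =>
      (h.ladder_ζ hσ).lt ν hν n (mem_univ n)
  · exact exists_not_solvable_int_of_countable hσ (h.E_eq hμ hσ ▸ singleton_nonempty 0)

end LadderPair

section Presentation

variable {μ : Cardinal.{u}} {S E : Set Ordinal.{u}} {η : Ordinal.{u} → Ordinal.{u} → Ordinal.{u}}
  {ζ : Ordinal.{u} → ℕ → Ordinal.{u}}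

variable (μ η ζ) in
/-- The functional sending `y_{δ,ν,n}` to `-2 ^ (k - n)` for `n ≤ k` and all other symbols to `0`
takes the value `1` at `w_{δ,ν,k}` and `0` at all other `w`. -/
theorem linearIndependent_w : LinearIndependent ℤ
    fun p : Ordinal.{u} × Ordinal.{u} × ℕ => w μ η ζ p.1 p.2.1 p.2.2 := by
  classical
  let dual : Sym.{u} → Ordinal.{u} × Ordinal.{u} × ℕ → ℤ
    | .y δ ν n => fun q => if (δ, ν) = (q.1, q.2.1) ∧ n ≤ q.2.2 then -2 ^ (q.2.2 - n) else 0
    | _ => 0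
  let T : (Sym.{u} →₀ ℤ) →ₗ[ℤ] Ordinal.{u} × Ordinal.{u} × ℕ → ℤ :=
    Finsupp.linearCombination ℤ dual
  have hT : ∀ δ ν n, T (w μ η ζ δ ν n) = Pi.single (δ, ν, n) 1 := by
    intro δ ν n
    ext ⟨δ', ν', k⟩
    have hw : T (w μ η ζ δ ν n) = (2 : ℤ) • dual (.y δ ν (n + 1)) - dual (.y δ ν n) := by
      simp [T, w, dual, apply_ite]
    rw [hw, Pi.single_apply, Pi.sub_apply, Pi.smul_apply]
    simp only [dual, Prod.mk.injEq, smul_eq_mul]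
    by_cases hδν : δ = δ' ∧ ν = ν'
    · obtain ⟨rfl, rfl⟩ := hδν
      rcases lt_trichotomy k n with hk | rfl | hk
      · simp [hk.not_ge, hk.ne, (hk.trans n.lt_succ_self).not_ge]
      · simp
      · have hpow : k - n = k - (n + 1) + 1 := by omega
        simp [hk.le, hk.ne', Nat.succ_le_of_lt hk, hpow, pow_succ']
    · simp [hδν, eq_comm, ← and_assoc]
  refine LinearIndependent.of_comp T ?_
  simp only [Function.comp_def, hT]
  exact Pi.linearIndependent_single_one _ ℤ

theorem small_F (hS : S ⊆ Iio (Order.succ μ).ord) (hE : E ⊆ Iio μ.ord.cof.ord) :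
    Small.{u} (F μ S E) := by
  have : Small.{u} S := small_subset hS
  have : Small.{u} E := small_subset hE
  let f : (S × E × ℕ) ⊕ (S × Iio μ.ord.cof.ord) ⊕ Iio (Order.succ μ).ord → Sym.{u} :=
    Sum.elim (fun p => .y p.1 p.2.1 p.2.2) (Sum.elim (fun p => .z p.1 p.2) fun b => .x b)
  have hf : symbols μ S E ⊆ range f := by
    rintro s (⟨δ, hδ, ν, hν, n, rfl⟩ | ⟨-, δ, hδ, j, hj, rfl⟩ | ⟨β, hβ, rfl⟩)
    · exact ⟨Sum.inl (⟨δ, hδ⟩, ⟨ν, hν⟩, n), rfl⟩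
    · exact ⟨Sum.inr (Sum.inl (⟨δ, hδ⟩, ⟨j, hj⟩)), rfl⟩
    · exact ⟨Sum.inr (Sum.inr ⟨β, hβ⟩), rfl⟩
  have : Small.{u} (symbols μ S E) := small_subset hf
  exact small_map (Finsupp.supportedEquivFinsupp (M := ℤ) (R := ℤ) (symbols μ S E)).toEquiv

theorem IsLadderPair.w_mem_F (h : IsLadderPair μ S η E ζ) (hμ : ℵ₀ ≤ μ) {δ ν : Ordinal.{u}}
    (hδ : δ ∈ S) (hν : ν ∈ E) (n : ℕ) : w μ η ζ δ ν n ∈ F μ S E := by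
  have hy : ∀ n, Finsupp.single (Sym.y δ ν n) (1 : ℤ) ∈ F μ S E := fun n =>
    Finsupp.single_mem_supported ℤ _ (Or.inl ⟨δ, hδ, ν, hν, n, rfl⟩)
  refine add_mem (sub_mem (sub_mem ((F μ S E).smul_mem _ (hy _)) (hy _)) ?_)
    (Finsupp.single_mem_supported ℤ _ (Or.inr (Or.inr
      ⟨_, (h.η_add_lt hμ hδ hν n).trans (h.S_subset hδ), rfl⟩)))
  split_ifs with hσ
  · exact Finsupp.single_mem_supported ℤ _ (Or.inr (Or.inl ⟨hσ, δ, hδ, _,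
      ((h.ladder_ζ hσ).lt ν hν n (mem_univ n)).trans (h.E_subset_Iio hμ hν), rfl⟩))
  · exact zero_mem _

theorem IsBuiltOn.exists_hom_apply_w {H A : Type u} [AddCommGroup H] [AddCommGroup A]
    (hμ : ℵ₀ ≤ μ) (hH : IsBuiltOn μ S η E ζ H) (hext : Subsingleton (ExtOne H A))
    (a : Ordinal.{u} → Ordinal.{u} → ℕ → A) :
    ∃ G : (Sym.{u} →₀ ℤ) →ₗ[ℤ] A, ∀ δ ∈ S, ∀ ν ∈ E, ∀ n, G (w μ η ζ δ ν n) = a δ ν n := by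
  classical
  obtain ⟨hpair, ⟨e⟩⟩ := hH
  let v : S × E × ℕ → F μ S E := fun p =>
    ⟨w μ η ζ p.1 p.2.1 p.2.2, hpair.w_mem_F hμ p.1.2 p.2.1.2 p.2.2⟩
  have hv : LinearIndependent ℤ v := by
    refine LinearIndependent.of_comp (F μ S E).subtype ?_
    exact (linearIndependent_w μ η ζ).comp
      (Prod.map Subtype.val (Prod.map Subtype.val id) : S × E × ℕ → _)
      (Subtype.val_injective.prodMap (Subtype.val_injective.prodMap Function.injective_id))
  have hspan : (K μ S η E ζ).submoduleOf (F μ S E) = Submodule.span ℤ (range v) := by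
    have hK : K μ S η E ζ = (Submodule.span ℤ (range v)).map (F μ S E).subtype := by
      rw [Submodule.map_span, ← range_comp, K]
      congr 1
      ext x
      constructor
      · rintro ⟨δ, hδ, ν, hν, n, rfl⟩
        exact ⟨(⟨δ, hδ⟩, ⟨ν, hν⟩, n), rfl⟩
      · rintro ⟨p, rfl⟩
        exact ⟨_, p.1.2, _, p.2.1.2, _, rfl⟩
    rw [Submodule.submoduleOf, hK, Submodule.comap_map_eq_of_injective (F μ S E).injective_subtype]
  have := small_F hpair.S_subset (hpair.E_subset_Iio hμ)
  rw [hspan] at e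
  obtain ⟨g, hg⟩ := exists_linearMap_of_subsingleton_extOne hv e hext fun p => a p.1 p.2.1 p.2.2
  refine ⟨g ∘ₗ Finsupp.restrictDom ℤ ℤ (symbols μ S E), fun δ hδ ν hν n => ?_⟩
  rw [← hg (⟨δ, hδ⟩, ⟨ν, hν⟩, n)]
  exact congrArg g (LinearMap.congr_fun (Finsupp.restrictDom_comp_subtype (symbols μ S E))
    (v (⟨δ, hδ⟩, ⟨ν, hν⟩, n)))

open Classical in
theorem IsBuiltOn.exists_solution {H A : Type u} [AddCommGroup H] [AddCommGroup A]
    (hμ : ℵ₀ ≤ μ) (hH : IsBuiltOn μ S η E ζ H) (hext : Subsingleton (ExtOne H A))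
    (a : Ordinal.{u} → Ordinal.{u} → ℕ → A) :
    ∃ (y : Ordinal.{u} → Ordinal.{u} → ℕ → A) (z : Ordinal.{u} → Ordinal.{u} → A)
      (x : Ordinal.{u} → A), ∀ δ ∈ S, ∀ ν ∈ E, ∀ n : ℕ,
        2 • y δ ν (n + 1) - y δ ν n - (if ℵ₀ < μ.ord.cof then z δ (ζ ν n) else 0)
          + x (η δ (ν + n)) = a δ ν n := by
  obtain ⟨G, hG⟩ := hH.exists_hom_apply_w hμ hext a
  refine ⟨fun δ ν n => G (Finsupp.single (.y δ ν n) 1), fun δ j => G (Finsupp.single (.z δ j) 1),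
    fun β => G (Finsupp.single (.x β) 1), fun δ hδ ν hν n => ?_⟩
  rw [← hG δ hδ ν hν n, w, map_add, map_sub, map_sub, map_zsmul, ofNat_zsmul, apply_ite G, map_zero]

/-- If all `B δ` fail, solve the equations of `H` for right-hand sides `a δ` that witness this, and
pick a `δ ∈ S` such that `B δ` contains all `x_β` with `β < δ`: modulo `B δ` the terms
`x_{η_δ(ν+n)}` disappear. -/
theorem IsBuiltOn.exists_solvable_quotient {H A : Type u} [AddCommGroup H] [AddCommGroup A]
    (hμ : ℵ₀ ≤ μ) (hH : IsBuiltOn μ S η E ζ H) (hext : Subsingleton (ExtOne H A))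
    (hcard : #A = Order.succ μ) : ∃ B : AddSubgroup A, #B ≤ μ ∧
      ∀ a : Ordinal.{u} → ℕ → A, Solvable μ.ord.cof E ζ fun ν n => (a ν n : A ⧸ B) := by
  obtain ⟨idx, hidx, hlt⟩ := exists_injective_lt_ord hcard
  let B : Ordinal.{u} → AddSubgroup A := fun δ => AddSubgroup.closure {a | idx a < δ}
  have hB : ∀ δ < (Order.succ μ).ord, #(B δ) ≤ μ := fun δ hδ =>
    mk_addSubgroup_closure_le hμ
      ((mk_setOf_lt_le_card hidx δ).trans (Order.lt_succ_iff.1 (lt_ord.1 hδ)))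
  by_contra! hno
  choose! a ha using fun δ (hδ : δ < (Order.succ μ).ord) => hno (B δ) (hB δ hδ)
  obtain ⟨y, z, x, hsol⟩ := hH.exists_solution hμ hext a
  obtain ⟨δ, hδS, hδ, hcl⟩ := hH.ladders.S_stationary.exists_closed_under
    (isRegular_succ hμ) (Order.lt_succ_of_le hμ) fun β _ => hlt (x β)
  refine ha δ hδ ⟨fun ν n => y δ ν n, fun j => z δ j, fun ν hν n => ?_⟩
  have hx : (x (η δ (ν + n)) : A ⧸ B δ) = 0 := (QuotientAddGroup.eq_zero_iff _).2
    (AddSubgroup.subset_closure (hcl _ (hH.ladders.η_add_lt hμ hδS hν n)))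
  simp only [← hsol δ hδS ν hν n, QuotientAddGroup.mk_add, hx, add_zero]
  split_ifs <;> simp

end Presentation

theorem mainTheorem7_general {μ : Cardinal.{u}} (hμ : ℵ₀ ≤ μ)
    (hpow : (2 : Cardinal.{u}) ^ μ < 2 ^ Order.succ μ) {S E : Set Ordinal.{u}}
    {η : Ordinal.{u} → Ordinal.{u} → Ordinal.{u}} {ζ : Ordinal.{u} → ℕ → Ordinal.{u}}
    (hE : ℵ₀ < μ.ord.cof → Diamond μ.ord.cof E) {H : Type u} [AddCommGroup H]
    (hH : IsBuiltOn μ S η E ζ H) {A : Type u} [AddCommGroup A] (hA : IsWhitehead A)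
    (hcard : #A = Order.succ μ) : Nontrivial (ExtOne H A) := by
  by_contra hext
  rw [not_nontrivial_iff_subsingleton] at hext
  obtain ⟨B, hB, hsolv⟩ := hH.exists_solvable_quotient hμ hext hcard
  obtain ⟨P, hBP, hP, hD⟩ := hA.liftsCharacters.exists_quotient_forall_liftsCharacters hμ hpow hB
  obtain ⟨ε, hε⟩ := hH.ladders.exists_not_solvable_int hμ hE
  have hPtop : ∃ g : A, g ∉ P := by
    by_contra! htop
    have hAP : #A ≤ #P := mk_le_of_injective (f := fun a => (⟨a, htop a⟩ : P))
      fun _ _ h => congrArg Subtype.val h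
    exact (Order.lt_succ μ).not_ge (hcard ▸ hAP.trans hP)
  obtain ⟨g, hg⟩ := hPtop
  have hsolvP : Solvable μ.ord.cof E ζ fun ν n => ε ν n • (g : A ⧸ P) :=
    (hsolv fun ν n => ε ν n • g).map (QuotientAddGroup.map B P (AddMonoidHom.id A) hBP)
  obtain ⟨D, hDμ, g', hg', hsolvD⟩ := hsolvP.exists_addSubgroup hμ
    ((hH.ladders.E_subset_Iio hμ).trans (Iio_subset_Iio (Ordinal.ord_cof_le _)))
  have hg'0 : g' ≠ 0 := fun h => hg ((QuotientAddGroup.eq_zero_iff g).1 (by rw [← hg', h]; rfl))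
  obtain ⟨φ, hφ⟩ := (hD D hDμ).exists_int_hom_apply_ne_zero hg'0
  exact hε (φ g') hφ (by simpa only [map_zsmul] using hsolvD.map φ)

end WhiteheadExt

theorem mainTheorem7 (hGCH : WhiteheadExt.GCH.{u})
    (μ : Cardinal.{u}) (hμ : μ.IsRegular)
    (S E : Set Ordinal.{u})
    (η : Ordinal.{u} → Ordinal.{u} → Ordinal.{u}) (ζ : Ordinal.{u} → ℕ → Ordinal.{u})
    (hE : Cardinal.aleph0 < μ → ∀ E' : Set Ordinal.{u}, E' ⊆ E →
      WhiteheadExt.IsStationaryIn μ E' → WhiteheadExt.Diamond μ E')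
    (H : Type u) [AddCommGroup H] (hH : WhiteheadExt.IsBuiltOn μ S η E ζ H)
    (A : Type u) [AddCommGroup A] (hA : WhiteheadExt.IsWhitehead A)
    (hcard : Cardinal.mk A = Order.succ μ) :
    Nontrivial (WhiteheadExt.ExtOne H A) := by
  have hstat := hH.ladders.E_stationary
  refine WhiteheadExt.mainTheorem7_general hμ.aleph0_le ?_ ?_ hH hA hcard
  · exact hGCH μ hμ.aleph0_le ▸ Cardinal.cantor _
  · rw [hμ.cof_ord] at hstat ⊢
    exact fun h => hE h E subset_rfl (hstat h)
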